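/- All groups are finite. A group is *semisimple* if it has no nontrivial Abelian normal subgroup. For a semisimple group $G$, let $\mathrm{Soc}(G)$ be the subgroup generated by the minimal normal subgroups of $G$, let $\mathrm{Fac}(\mathrm{Soc}(G))$ be the set of simple direct factors of $\mathrm{Soc}(G)$, and let $\mathrm{PKer}(G)=\{g\in G : gSg^{-1}=S \text{ for all } S\in \mathrm{Fac}(\mathrm{Soc}(G))\}$ be the kernel of the conjugation action of $G$ on $\mathrm{Fac}(\mathrm{Soc}(G))$. *The $2$-ary Version II pebble game* on $G$ and $H$ with $k$ pairs of pebbles, all initially beside the groups: in each round (1) Spoiler picks up one or two pairs of pebbles; (2) Spoiler wins if the map given by the pairs $(v_\ell,v'_\ell)\in G\times H$ that are still pebbled is not well-defined and injective, or does not extend to an isomorphism $\langle v_1,v_2,\dots\rangle\to\langle v'_1,v'_2,\dots\rangle$; otherwise (3) Duplicator selects a bijection $f:G\to H$; (4) Spoiler places each pebble in hand on an element $v$ of $G$, and its partner is placed on $f(v)$. **Corollary.** Let $G$ and $H$ be semisimple groups of the same order, let $\mathrm{Fac}(\mathrm{Soc}(G))=\{S_1,\dots,S_m\}$ (with the $S_i$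 distinct), and let $S_i=\langle x_i,y_i\rangle$ for each $i$. Put $x:=x_1\cdots x_m$ and $y:=y_1\cdots y_m$. In the first round, let $f:G\to H$ be the bijection that Duplicator selects, and let Spoiler pebble $(x,y)\mapsto(f(x),f(y))$. In the second round, let Spoiler pick up two other pairs of pebbles, and let $f':G\to H$ be the bijection that Duplicator selects. If $f'$ does not restrict to a group isomorphism from $\mathrm{PKer}(G)$ onto $\mathrm{PKer}(H)$, then Spoiler can win with $5$ additional pebbles and $5$ additional rounds, that is, in the game with $7$ pairs of pebbles in total and within $6$ rounds in total (the second round, in which $f'$ is selected, being the first of the $5$ additional ones). -/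

import Mathlib

namespace PebbleGame

/-! ### Group-theoretic notions -/

section GroupNotions

variable (G : Type*) [Group G]

/-- A group is semisimple if its only Abelian normal subgroup is the trivial one. -/
def IsSemisimple : Prop :=
  ∀ N : Subgroup G, N.Normal → (∀ a ∈ N, ∀ b ∈ N, a * b = b * a) → N = ⊥

variable {G} in
/-- `N` is a minimal normal subgroup of `G`: minimal among the nontrivial normal subgroups. -/
def IsMinimalNormal (N : Subgroup G) : Prop :=
  Minimal (fun M : Subgroup G => M.Normal ∧ M ≠ ⊥) N

/-- The socle `Soc(G)`: the subgroup generated by all the minimal normal subgroups of `G`. -/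
def socle : Subgroup G :=
  sSup {N : Subgroup G | IsMinimalNormal N}

variable {G} in
/-- `N` is the internal direct product of its subgroups `S` and `C`. -/
def IsInternalDirectProduct (N S C : Subgroup G) : Prop :=
  (∀ s ∈ S, ∀ c ∈ C, s * c = c * s) ∧ S ⊓ C = ⊥ ∧ S ⊔ C = N

/-- `Fac(Soc(G))`: the set of simple direct factors of the socle of `G`. -/
def socleFactors : Set (Subgroup G) :=
  {S | IsSimpleGroup S ∧ ∃ C : Subgroup G, IsInternalDirectProduct (socle G) S C}

/-- `PKer(G)`, for a semisimple group `G` (one whose solvable radical is trivial): the kernel of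
the action of `G` by conjugation on the set `Fac(Soc(G))`, that is, the subgroup of all `g` with
`g S g⁻¹ = S` for every simple direct factor `S` of the socle. -/
def PKer : Subgroup G where
  carrier := {g | ∀ S ∈ socleFactors G, S.map (MulAut.conj g).toMonoidHom = S}
  one_mem' := by
    intro S _
    ext a
    simp
  mul_mem' := by
    intro a b ha hb S hS
    have h : (MulAut.conj (a * b)).toMonoidHom =
        (MulAut.conj a).toMonoidHom.comp (MulAut.conj b).toMonoidHom := by
      ext c
      simp [mul_assoc]
    rw [h, ← Subgroup.map_map, hb S hS, ha S hS]
  inv_mem' := by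
    intro a ha S hS
    have h : (MulAut.conj a⁻¹).toMonoidHom.comp (MulAut.conj a).toMonoidHom =
        MonoidHom.id G := by
      ext c
      simp [mul_assoc]
    have h2 := congrArg (Subgroup.map (MulAut.conj a⁻¹).toMonoidHom) (ha S hS)
    rw [Subgroup.map_map, h, Subgroup.map_id] at h2
    exact h2.symm

end GroupNotions

/-! ### The 2-ary bijective pebble game, Version II -/

section Game

variable {G H : Type*} [Group G] [Group H]

/-- The tuples `g` and `h` give a marked isomorphism: they give a well-defined map `g i ↦ h i`,
and this map extends to an isomorphism of the subgroups that the two tuples generate. -/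
def MarkedIsomorphic {ι : Type*} (g : ι → G) (h : ι → H) : Prop :=
  (∀ i j, g i = g j ↔ h i = h j) ∧
    ∃ e : Subgroup.closure (Set.range g) ≃* Subgroup.closure (Set.range h),
      ∀ i, (e ⟨g i, Subgroup.subset_closure (Set.mem_range_self i)⟩ : H) = h i

/-- A position of the game with `k` pairs of pebbles: the `i`-th pair either lies beside the
groups (`none`), or one of its pebbles is on an element of `G` and the other one on an element
of `H`. -/
abbrev Position (G H : Type*) (k : ℕ) : Type _ := Fin k → Option (G × H)

/-- The initial position: all pebbles lie beside the groups. -/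
def Position.initial (G H : Type*) (k : ℕ) : Position G H k := fun _ => none

/-- The elements that are pebbled in a position give a marked isomorphism. -/
def Position.GivesMarkedIso {k : ℕ} (P : Position G H k) : Prop :=
  MarkedIsomorphic (fun i : {i : Fin k // (P i).isSome} => ((P i.1).get i.2).1)
    (fun i : {i : Fin k // (P i).isSome} => ((P i.1).get i.2).2)

/-- The pairs of pebbles `i` and `j` are picked up (only one pair if `i = j`). -/
def Position.pickUp {k : ℕ} (P : Position G H k) (i j : Fin k) : Position G H k :=
  Function.update (Function.update P i none) j none

/-- The `i`-th pebble is placed on `u`, the `j`-th one on `v`, and their partners on `f u`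
and `f v`. -/
def Position.place {k : ℕ} (P : Position G H k) (i j : Fin k) (f : G ≃ H) (u v : G) :
    Position G H k :=
  Function.update (Function.update P i (some (u, f u))) j (some (v, f v))

/-- Spoiler has a strategy to win from position `P` within `r` rounds of the 2-ary Version II
game. A round: (1) Spoiler picks up one or two pairs of pebbles; (2) Spoiler has won if the
elements that are still pebbled do not give a marked isomorphism; otherwise (3) Duplicator chooses
a bijection `f : G → H`; (4) Spoiler places the pebbles in hand on elements of `G`, and their
partners go to the images under `f`. -/
def SpoilerWins {k : ℕ} : ℕ → Position G H k → Prop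
  | 0, _ => False
  | r + 1, P => ∃ i j : Fin k, ¬ (P.pickUp i j).GivesMarkedIso ∨
      ∀ f : G ≃ H, ∃ u v : G, (i = j → u = v) ∧
        SpoilerWins r ((P.pickUp i j).place i j f u v)

/-- Spoiler can win within `r` rounds, the current one included, where in the current round the
pebbles `i` and `j` have been picked up, `P` is the position after this, and Duplicator has just
chosen the bijection `f`. -/
def SpoilerWinsAgainst {k : ℕ} (r : ℕ) (P : Position G H k) (i j : Fin k) (f : G ≃ H) : Prop :=
  ∃ u v : G, (i = j → u = v) ∧ SpoilerWins (r - 1) (P.place i j f u v)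

end Game

/-- The map `f` restricts to a group isomorphism from `A` onto `B`. -/
def RestrictsToIso {G H : Type*} [Group G] [Group H] (f : G → H)
    (A : Subgroup G) (B : Subgroup H) : Prop :=
  ∃ e : A ≃* B, ∀ a : A, (e a : H) = f a

end PebbleGame

/-!
The four pebbled elements `x, y, u, v` give a marked isomorphism exactly when the subgroup of `G × H`
generated by the pairs `(x, f x), (y, f y), (u, f' u), (v, f' v)` is the graph of an isomorphism
between its projections. If Spoiler cannot win by placing the two pebbles in hand and checking the
position at the start of the next round, this holds for all `u` and `v`; call it `(∗)`. It is shown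
that `(∗)` already makes `f'` restrict to an isomorphism from `PKer G` onto `PKer H`.

Let `S` be a simple factor of the socle of `G`, and `a ≠ 1` in `S`. Conjugation by `x` and `y` acts
on `S = ⟨xᵢ, yᵢ⟩` as conjugation by `xᵢ` and `yᵢ`, so the simple group `S` lies in `⟨x, y, a⟩`
(`factor_le_closure`). Hence the graph generated by `(x, f x), (y, f y), (a, f' a)` contains `(c, f' c)`
for every `c ∈ S` (`LocallyIso.mem_graph`): on `S` the map `f'` is the restriction of one isomorphism,
and by placing the second pebble on any `g` it is seen that `f'` respects conjugation of `S` by `g`.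

Two distinct simple factors commute, so the conjugates of `S` are equal to `S` or commute with it. By
the previous remark this passes to `f' S`, and a simple subgroup of a semisimple group with this
property is a simple factor of the socle (`mem_socleFactors_of_conj`). Since nothing but `1`
centralizes all simple factors (`eq_one_of_commute_factors`), every simple factor of the socle of `H`
arises as some `f' S`: an element of a missing factor would commute with all `f' S`, and its preimage
with all `S`. Consequently `g ∈ PKer G` if and only if `f' g ∈ PKer H`, and `f' (a * b)` and
`f' a * f' b` induce the same conjugation on every factor of `H`, so they are equal.
-/

namespace PebbleGame

open Subgroup

/-! ### Simple factors of the socle of a semisimple group -/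

section Socle

variable {G : Type*} [Group G]

theorem map_conj_eq_iff {S : Subgroup G} {g : G} :
    S.map (MulAut.conj g).toMonoidHom = S ↔ ∀ s, s ∈ S ↔ g * s * g⁻¹ ∈ S :=
  mem_normalizer_iff_map_conj_eq.symm.trans mem_normalizer_iff

/-- Two subgroups that normalize each other and meet trivially commute elementwise. -/
theorem commute_of_normalizing {A B : Subgroup G} (hA : ∀ b ∈ B, ∀ a ∈ A, b * a * b⁻¹ ∈ A)
    (hB : ∀ a ∈ A, ∀ b ∈ B, a * b * a⁻¹ ∈ B) (hAB : A ⊓ B = ⊥) :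
    ∀ a ∈ A, ∀ b ∈ B, a * b = b * a := by
  intro a ha b hb
  have h : a * b * a⁻¹ * b⁻¹ ∈ A ⊓ B := by
    refine ⟨?_, B.mul_mem (hB a ha b hb) (B.inv_mem hb)⟩
    have := A.mul_mem ha (hA b hb a⁻¹ (A.inv_mem ha))
    simpa [mul_assoc] using this
  rw [hAB, mem_bot, mul_inv_eq_one, mul_inv_eq_iff_eq_mul] at h
  exact h

theorem eq_bot_or_le_of_isSimpleGroup {S L : Subgroup G} (hS : IsSimpleGroup S)
    (hL : ∀ s ∈ S, ∀ a ∈ L, s * a * s⁻¹ ∈ L) : S ⊓ L = ⊥ ∨ S ≤ L := by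
  have hn : (L.subgroupOf S).Normal := ⟨fun a ha s => hL s s.2 a ha⟩
  rcases hn.eq_bot_or_eq_top with h | h
  · left
    rw [inf_comm]
    exact disjoint_iff.1 (subgroupOf_eq_bot.1 h)
  · right
    exact subgroupOf_eq_top.1 h

theorem IsInternalDirectProduct.conj_mem {N S C : Subgroup G}
    (h : IsInternalDirectProduct N S C) : ∀ n ∈ N, ∀ s ∈ S, n * s * n⁻¹ ∈ S := by
  obtain ⟨hc, -, rfl⟩ := h
  have hle : S ⊔ C ≤ normalizer (S : Set G) := by
    refine sup_le le_normalizer (le_normalizer_iff.2 fun c hcC s hs => ?_)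
    rwa [← hc s hs c hcC, mul_inv_cancel_right]
  exact le_normalizer_iff.1 hle

theorem le_socle_of_mem_socleFactors {S : Subgroup G} (hS : S ∈ socleFactors G) :
    S ≤ socle G := by
  obtain ⟨-, C, -, -, h⟩ := hS
  exact h ▸ le_sup_left

theorem commute_of_mem_socleFactors {S T : Subgroup G} (hS : S ∈ socleFactors G)
    (hT : T ∈ socleFactors G) (hST : S ≠ T) : ∀ s ∈ S, ∀ t ∈ T, s * t = t * s := by
  have hSs := le_socle_of_mem_socleFactors hS
  have hTs := le_socle_of_mem_socleFactors hT
  obtain ⟨hS1, C, hC⟩ := hS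
  obtain ⟨hT1, D, hD⟩ := hT
  have h1 : ∀ t ∈ T, ∀ s ∈ S, t * s * t⁻¹ ∈ S := fun t ht => hC.conj_mem t (hTs ht)
  have h2 : ∀ s ∈ S, ∀ t ∈ T, s * t * s⁻¹ ∈ T := fun s hs => hD.conj_mem s (hSs hs)
  refine commute_of_normalizing h1 h2 ?_
  rcases eq_bot_or_le_of_isSimpleGroup hS1 h2 with h | h
  · exact h
  rcases eq_bot_or_le_of_isSimpleGroup hT1 h1 with h' | h'
  · rwa [inf_comm]
  · exact absurd (le_antisymm h h') hST

theorem IsMinimalNormal.map_conj {N : Subgroup G} (hN : IsMinimalNormal N) (g : G) :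
    N.map (MulAut.conj g).toMonoidHom = N :=
  map_conj_eq_iff.2 fun s => by
    constructor
    · exact fun hs => hN.prop.1.conj_mem s hs g
    · intro hs
      simpa [mul_assoc] using hN.prop.1.conj_mem _ hs g⁻¹

theorem socle_map_conj (g : G) : (socle G).map (MulAut.conj g).toMonoidHom = socle G := by
  unfold socle
  rw [sSup_eq_iSup, Subgroup.map_iSup]
  refine iSup_congr fun N => ?_
  rw [Subgroup.map_iSup]
  exact iSup_congr fun hN => hN.map_conj g

theorem map_conj_mem_socleFactors {S : Subgroup G} (hS : S ∈ socleFactors G) (g : G) :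
    S.map (MulAut.conj g).toMonoidHom ∈ socleFactors G := by
  obtain ⟨hS1, C, hc, hi, hs⟩ := hS
  have hinj : Function.Injective (MulAut.conj g).toMonoidHom := (MulAut.conj g).injective
  refine ⟨((S.equivMapOfInjective _ hinj).isSimpleGroup_congr).1 hS1,
    C.map (MulAut.conj g).toMonoidHom, ?_, ?_, ?_⟩
  · rintro _ ⟨s, hs, rfl⟩ _ ⟨c, hcC, rfl⟩
    rw [← map_mul, ← map_mul, hc s hs c hcC]
  · rw [← Subgroup.map_inf _ _ _ hinj, hi, Subgroup.map_bot]
  · rw [← Subgroup.map_sup, hs, socle_map_conj]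

theorem normalClosure_le_centralizer {T : Subgroup G} {a : G}
    (h : ∀ g : G, ∀ t ∈ T, a * (g * t * g⁻¹) = g * t * g⁻¹ * a) :
    ∀ n ∈ normalClosure (T : Set G), a * n = n * a := by
  have hle : normalClosure (T : Set G) ≤ centralizer {a} := by
    refine (closure_le _).2 fun n hn => ?_
    obtain ⟨t, ht, hc⟩ := Group.mem_conjugatesOfSet_iff.1 hn
    obtain ⟨g, rfl⟩ := isConj_iff.1 hc
    exact mem_centralizer_singleton_iff.2 (h g t ht).symm
  intro n hn
  exact (mem_centralizer_singleton_iff.1 (hle hn)).symm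

/-- A subgroup `T` whose conjugates are equal to `T` or commute with it. -/
def HasCommutingConjugates (T : Subgroup G) : Prop :=
  ∀ g : G, T.map (MulAut.conj g).toMonoidHom = T ∨
    ∀ s ∈ T, ∀ t ∈ T, s * (g * t * g⁻¹) = g * t * g⁻¹ * s

/-- The normal closure of `T` normalizes every subgroup of `T` that `T` normalizes. -/
theorem HasCommutingConjugates.conj_mem {T L : Subgroup G} (hT : HasCommutingConjugates T)
    (hLT : L ≤ T) (hL : ∀ t ∈ T, ∀ a ∈ L, t * a * t⁻¹ ∈ L) :
    ∀ n ∈ normalClosure (T : Set G), ∀ a ∈ L, n * a * n⁻¹ ∈ L := by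
  have hTL : T ≤ normalizer (L : Set G) := le_normalizer_iff.2 hL
  have hle : normalClosure (T : Set G) ≤ normalizer (L : Set G) := by
    refine (closure_le _).2 fun n hn => ?_
    obtain ⟨t, ht, hc⟩ := Group.mem_conjugatesOfSet_iff.1 hn
    obtain ⟨g, rfl⟩ := isConj_iff.1 hc
    rcases hT g with h | h
    · exact hTL ((map_conj_eq_iff.1 h t).1 ht)
    · have hc : ∀ a ∈ L, a * (g * t * g⁻¹) = g * t * g⁻¹ * a := fun a ha => h a (hLT ha) t ht
      exact centralizer_le_normalizer _ (mem_centralizer_iff.2 hc)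
  exact le_normalizer_iff.1 hle

theorem HasCommutingConjugates.not_commutative (hG : IsSemisimple G) {T : Subgroup G}
    (hT : HasCommutingConjugates T) (hne : T ≠ ⊥) : ¬ ∀ a ∈ T, ∀ b ∈ T, a * b = b * a := by
  intro hab
  have h1 : ∀ g : G, ∀ s ∈ T, ∀ t ∈ T, s * (g * t * g⁻¹) = g * t * g⁻¹ * s := by
    intro g s hs t ht
    rcases hT g with h | h
    · exact hab s hs _ ((map_conj_eq_iff.1 h t).1 ht)
    · exact h s hs t ht
  have h2 : ∀ n ∈ normalClosure (T : Set G), ∀ m ∈ normalClosure (T : Set G), n * m = m * n := by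
    intro n hn
    refine normalClosure_le_centralizer fun g t ht => ?_
    refine (normalClosure_le_centralizer (fun k s hs => ?_) n hn).symm
    -- conjugating by `g⁻¹` reduces two arbitrary conjugates to `T` and one conjugate
    have := h1 (g⁻¹ * k) t ht s hs
    calc g * t * g⁻¹ * (k * s * k⁻¹) = g * (t * (g⁻¹ * k * s * (g⁻¹ * k)⁻¹)) * g⁻¹ := by group
      _ = k * s * k⁻¹ * (g * t * g⁻¹) := by rw [this]; group
  have h3 := hG _ normalClosure_normal h2
  exact hne (le_bot_iff.1 (h3 ▸ subset_normalClosure))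

theorem HasCommutingConjugates.isMinimalNormal (hG : IsSemisimple G) {T : Subgroup G}
    (hs : IsSimpleGroup T) (hT : HasCommutingConjugates T) :
    IsMinimalNormal (normalClosure (T : Set G)) := by
  have hTN : T ≤ normalClosure (T : Set G) := subset_normalClosure
  have hne : T ≠ ⊥ := (nontrivial_iff_ne_bot T).1 hs.toNontrivial
  refine ⟨⟨normalClosure_normal, fun h => hne (le_bot_iff.1 (h ▸ hTN))⟩, ?_⟩
  rintro M ⟨hM, hMne⟩ hMN
  rcases eq_bot_or_le_of_isSimpleGroup hs (fun t _ a ha => hM.conj_mem a ha t) with h | h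
  · exfalso
    have hc := commute_of_normalizing
      (fun m hm t ht => hT.conj_mem le_rfl
        (fun t ht a ha => T.mul_mem (T.mul_mem ht ha) (T.inv_mem ht)) m (hMN hm) t ht)
      (fun t _ m hm => hM.conj_mem m hm t) h
    refine hMne (hG M hM fun a ha b hb => ?_)
    refine normalClosure_le_centralizer (fun g t ht => ?_) b (hMN hb)
    have := hc t ht _ (hM.conj_mem a ha g⁻¹)
    calc a * (g * t * g⁻¹) = g * (g⁻¹ * a * g⁻¹⁻¹ * t) * g⁻¹ := by group
      _ = g * t * g⁻¹ * a := by rw [← this]; group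
  · exact normalClosure_le_normal h

/-- The simple factors of the socle of a semisimple group are recognized by their conjugates alone;
the socle does not enter the criterion. -/
theorem mem_socleFactors_of_conj (hG : IsSemisimple G) {T : Subgroup G}
    (hs : IsSimpleGroup T) (hT : HasCommutingConjugates T) : T ∈ socleFactors G := by
  have hN := hT.isMinimalNormal hG hs
  have hTN : T ≤ normalClosure (T : Set G) := subset_normalClosure
  have hNs : normalClosure (T : Set G) ≤ socle G := le_sSup hN
  have hne : T ≠ ⊥ := (nontrivial_iff_ne_bot T).1 hs.toNontrivial
  have hn : ∀ t ∈ T, ∀ a ∈ centralizer (T : Set G), t * a * t⁻¹ ∈ centralizer (T : Set G) := by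
    intro t ht a ha
    rwa [mem_centralizer_iff.1 ha t ht, mul_inv_cancel_right]
  refine ⟨hs, centralizer (T : Set G) ⊓ socle G, ?_, ?_, le_antisymm ?_ ?_⟩
  · exact fun s hs c hc => mem_centralizer_iff.1 hc.1 s hs
  · rcases eq_bot_or_le_of_isSimpleGroup (L := centralizer (T : Set G)) hs hn with h | h
    · rw [← inf_assoc, h, bot_inf_eq]
    · exact absurd (fun a ha b hb => mem_centralizer_iff.1 (h hb) a ha)
        (hT.not_commutative hG hne)
  · exact sup_le (hTN.trans hNs) inf_le_right
  · refine sSup_le fun M (hM : IsMinimalNormal M) => ?_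
    by_cases hMN : M = normalClosure (T : Set G)
    · rw [hMN]
      refine (closure_le _).2 fun n hn => ?_
      have hns : n ∈ socle G := hNs (subset_closure hn)
      obtain ⟨t, ht, hc⟩ := Group.mem_conjugatesOfSet_iff.1 hn
      obtain ⟨g, rfl⟩ := isConj_iff.1 hc
      rcases hT g with h | h
      · exact mem_sup_left ((map_conj_eq_iff.1 h t).1 ht)
      · exact mem_sup_right ⟨mem_centralizer_iff.2 fun s hs => h s hs t ht, hns⟩
    · have hd : M ⊓ normalClosure (T : Set G) = ⊥ := by
        by_contra hne
        have hn : (M ⊓ normalClosure (T : Set G)).Normal :=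
          ⟨fun a ha g => ⟨hM.prop.1.conj_mem a ha.1 g, normalClosure_normal.conj_mem a ha.2 g⟩⟩
        have h1 := hM.le_of_le ⟨hn, hne⟩ inf_le_left
        have h2 := hN.le_of_le ⟨hn, hne⟩ inf_le_right
        exact hMN (le_antisymm (h1.trans inf_le_right) (h2.trans inf_le_left))
      have hc := commute_of_normalizing (fun b _ a ha => hM.prop.1.conj_mem a ha b)
        (fun a _ b hb => normalClosure_normal.conj_mem b hb a) hd
      exact fun a ha => mem_sup_right
        ⟨mem_centralizer_iff.2 fun t ht => (hc a ha t (hTN ht)).symm, (le_sSup hM : M ≤ socle G) ha⟩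

theorem hasCommutingConjugates_of_mem_socleFactors {S : Subgroup G} (hS : S ∈ socleFactors G) :
    HasCommutingConjugates S := by
  intro g
  by_cases h : S.map (MulAut.conj g).toMonoidHom = S
  · exact Or.inl h
  · refine Or.inr fun s hs t ht => ?_
    exact commute_of_mem_socleFactors hS (map_conj_mem_socleFactors hS g) (Ne.symm h) s hs _
      ⟨t, ht, rfl⟩

/-- Every nontrivial normal subgroup of a finite semisimple group contains a simple factor of the
socle, namely a minimal normal subgroup of a minimal normal subgroup. -/
theorem exists_socleFactor_le [Finite G] (hG : IsSemisimple G) {K : Subgroup G} (hK : K.Normal)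
    (hne : K ≠ ⊥) : ∃ T ∈ socleFactors G, T ≤ K := by
  obtain ⟨M, hMK, hM⟩ := (Set.toFinite {M : Subgroup G | M.Normal ∧ M ≠ ⊥}).exists_le_minimal
    (a := K) ⟨hK, hne⟩
  obtain ⟨T, hTM, hT⟩ := (Set.toFinite {T : Subgroup G | T ≠ ⊥ ∧ T ≤ M ∧
    ∀ m ∈ M, ∀ t ∈ T, m * t * m⁻¹ ∈ T}).exists_le_minimal
    (a := M) ⟨hM.prop.2, le_rfl, fun m hm t ht => M.mul_mem (M.mul_mem hm ht) (M.inv_mem hm)⟩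
  obtain ⟨hTne, -, hTn⟩ := hT.prop
  refine ⟨T, ?_, hTM.trans hMK⟩
  have hMn : M.Normal := hM.prop.1
  have hTM' : normalClosure (T : Set G) = M :=
    le_antisymm (normalClosure_le_normal hTM) (hM.le_of_le
      ⟨normalClosure_normal, fun h => hTne (le_bot_iff.1 (h ▸ subset_normalClosure))⟩
      (normalClosure_le_normal hTM))
  have hTc : HasCommutingConjugates T := by
    intro g
    set U := T.map (MulAut.conj g).toMonoidHom with hU
    have hUM : U ≤ M := by
      rintro _ ⟨t, ht, rfl⟩
      exact hMn.conj_mem t (hTM ht) g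
    have hUn : ∀ m ∈ M, ∀ u ∈ U, m * u * m⁻¹ ∈ U := by
      rintro m hm _ ⟨t, ht, rfl⟩
      refine ⟨_, hTn _ (hMn.conj_mem m hm g⁻¹) t ht, ?_⟩
      simp [mul_assoc]
    by_cases hd : T ⊓ U = ⊥
    · exact Or.inr fun s hs t ht => commute_of_normalizing (fun u hu => hTn u (hUM hu))
        (fun t ht => hUn t (hTM ht)) hd s hs _ ⟨t, ht, rfl⟩
    · left
      have hTU : T ≤ U := (hT.le_of_le ⟨hd, inf_le_left.trans hTM,
        fun m hm t ht => ⟨hTn m hm t ht.1, hUn m hm t ht.2⟩⟩ inf_le_left).trans inf_le_right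
      refine (eq_of_le_of_card_ge hTU ?_).symm
      exact (card_map_of_injective (MulAut.conj g).injective).le
  refine mem_socleFactors_of_conj hG ?_ hTc
  have hnt : Nontrivial T := (nontrivial_iff_ne_bot T).2 hTne
  refine ⟨fun L hL => ?_⟩
  by_cases hLb : L = ⊥
  · exact Or.inl hLb
  right
  have hLT : L.map T.subtype ≤ T := map_subtype_le L
  have hLn : ∀ t ∈ T, ∀ a ∈ L.map T.subtype, t * a * t⁻¹ ∈ L.map T.subtype := by
    rintro t ht _ ⟨a, ha, rfl⟩
    exact ⟨_, hL.conj_mem a ha ⟨t, ht⟩, rfl⟩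
  have hle : T ≤ L.map T.subtype := by
    refine hT.le_of_le ⟨?_, hLT.trans hTM, ?_⟩ hLT
    · rwa [Ne, map_eq_bot_iff_of_injective _ T.subtype_injective]
    · exact fun m hm => hTc.conj_mem hLT hLn m (hTM'.symm ▸ hm)
  refine eq_top_iff.2 fun t _ => ?_
  obtain ⟨a, ha, hat⟩ := hle t.2
  have : a = t := Subtype.ext hat
  exact this ▸ ha

theorem exists_ne_one_of_mem_socleFactors {S : Subgroup G} (hS : S ∈ socleFactors G) :
    ∃ a ∈ S, a ≠ 1 :=
  have := hS.1.toNontrivial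
  exists_ne_one_of_nontrivial S

/-- Only `1` centralizes all simple factors of the socle of a finite semisimple group. -/
theorem eq_one_of_commute_factors [Finite G] (hG : IsSemisimple G) {g : G}
    (hg : ∀ S ∈ socleFactors G, ∀ s ∈ S, g * s = s * g) : g = 1 := by
  let K : Subgroup G := ⨅ S ∈ socleFactors G, centralizer (S : Set G)
  have hmem : ∀ a, a ∈ K ↔ ∀ S ∈ socleFactors G, ∀ s ∈ S, a * s = s * a := by
    intro a
    simp only [K, mem_iInf, mem_centralizer_iff, SetLike.mem_coe]
    exact forall₂_congr fun S _ => forall₂_congr fun s _ => eq_comm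
  have hK : K.Normal := by
    refine ⟨fun a ha b => (hmem _).2 fun S hS s hs => ?_⟩
    have := (hmem a).1 ha _ (map_conj_mem_socleFactors hS b⁻¹) _ ⟨s, hs, rfl⟩
    have h2 : a * (b⁻¹ * s * b) = b⁻¹ * s * b * a := by simpa using this
    calc b * a * b⁻¹ * s = b * (a * (b⁻¹ * s * b)) * b⁻¹ := by group
      _ = s * (b * a * b⁻¹) := by rw [h2]; group
  have hgK : g ∈ K := (hmem g).2 hg
  by_contra hg1
  obtain ⟨T, hT, hTK⟩ := exists_socleFactor_le hG hK (fun h => hg1 (mem_bot.1 (h ▸ hgK)))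
  exact (hasCommutingConjugates_of_mem_socleFactors hT).not_commutative hG
    ((nontrivial_iff_ne_bot T).1 hT.1.toNontrivial)
    fun a ha b hb => (hmem a).1 (hTK ha) T hT b hb

theorem conj_prod_of_commute {ι : Type*} {S : ι → Subgroup G} {x : ι → G}
    (hx : ∀ i, x i ∈ S i) (hc : ∀ i j, i ≠ j → ∀ s ∈ S i, ∀ t ∈ S j, s * t = t * s)
    (i : ι) {c : G} (hcS : c ∈ S i) (l : List ι) (hl : l.Nodup) :
    (i ∉ l → (l.map x).prod * c * (l.map x).prod⁻¹ = c) ∧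
      (i ∈ l → (l.map x).prod * c * (l.map x).prod⁻¹ = x i * c * (x i)⁻¹) := by
  induction l with
  | nil => simp
  | cons j l ih =>
    obtain ⟨hj, hl'⟩ := List.nodup_cons.1 hl
    obtain ⟨ih1, ih2⟩ := ih hl'
    have hcons : ((j :: l).map x).prod * c * ((j :: l).map x).prod⁻¹ =
        x j * ((l.map x).prod * c * (l.map x).prod⁻¹) * (x j)⁻¹ := by
      simp [mul_assoc]
    rw [hcons]
    constructor
    · intro hi
      rw [List.mem_cons, not_or] at hi
      rw [ih1 hi.2, hc j i (Ne.symm hi.1) _ (hx j) _ hcS, mul_inv_cancel_right]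
    · intro hi
      rcases List.mem_cons.1 hi with rfl | hi
      · rw [ih1 hj]
      · have hij : j ≠ i := fun h => hj (h ▸ hi)
        rw [ih2 hi, hc j i hij _ (hx j) _
          ((S i).mul_mem ((S i).mul_mem (hx i) hcS) ((S i).inv_mem (hx i))),
          mul_inv_cancel_right]

/-- One nontrivial element of a simple factor generates the whole factor together with `∏ xᵢ` and
`∏ yᵢ`, which act on the factor as its two generators do. -/
theorem factor_le_closure {m : ℕ} {S : Fin m → Subgroup G} (hSinj : Function.Injective S)
    (hS : ∀ i, S i ∈ socleFactors G) {x y : Fin m → G} (hgen : ∀ i, closure {x i, y i} = S i)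
    (i : Fin m) {a : G} (ha : a ∈ S i) (ha1 : a ≠ 1) :
    S i ≤ closure {(List.ofFn x).prod, (List.ofFn y).prod, a} := by
  set X := (List.ofFn x).prod with hX
  set Y := (List.ofFn y).prod with hY
  set K := closure {X, Y, a} with hK
  have hxS : ∀ i, x i ∈ S i := fun i => hgen i ▸ subset_closure (by simp)
  have hyS : ∀ i, y i ∈ S i := fun i => hgen i ▸ subset_closure (by simp)
  have hc : ∀ i j, i ≠ j → ∀ s ∈ S i, ∀ t ∈ S j, s * t = t * s :=
    fun i j hij => commute_of_mem_socleFactors (hS i) (hS j) (hSinj.ne hij)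
  have hXc : ∀ c ∈ S i, X * c * X⁻¹ = x i * c * (x i)⁻¹ := fun c hcS => by
    rw [hX, List.ofFn_eq_map]
    exact (conj_prod_of_commute hxS hc i hcS _ (List.nodup_finRange m)).2 (List.mem_finRange i)
  have hYc : ∀ c ∈ S i, Y * c * Y⁻¹ = y i * c * (y i)⁻¹ := fun c hcS => by
    rw [hY, List.ofFn_eq_map]
    exact (conj_prod_of_commute hyS hc i hcS _ (List.nodup_finRange m)).2 (List.mem_finRange i)
  have hnorm : ∀ z ∈ S i, ∀ Z ∈ K, (∀ c ∈ S i, Z * c * Z⁻¹ = z * c * z⁻¹) →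
      z ∈ normalizer ((K ⊓ S i : Subgroup G) : Set G) := by
    intro z hz Z hZ h
    have hSz : ∀ c, c ∈ S i ↔ z * c * z⁻¹ ∈ S i := fun c => by
      rw [mul_mem_cancel_right (inv_mem hz), mul_mem_cancel_left hz]
    have hKZ : ∀ c, c ∈ K ↔ Z * c * Z⁻¹ ∈ K := fun c => by
      rw [mul_mem_cancel_right (inv_mem hZ), mul_mem_cancel_left hZ]
    refine mem_normalizer_iff.2 fun c => ?_
    rw [mem_inf, mem_inf, ← hSz c, hKZ c]
    exact and_congr_left fun hcS => by rw [h c hcS]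
  have hle : S i ≤ normalizer ((K ⊓ S i : Subgroup G) : Set G) := by
    conv_lhs => rw [← hgen i]
    rw [closure_le]
    rintro z (rfl | rfl)
    · exact hnorm _ (hxS i) X (subset_closure (by simp)) hXc
    · exact hnorm _ (hyS i) Y (subset_closure (by simp)) hYc
  rcases eq_bot_or_le_of_isSimpleGroup (hS i).1
    (le_normalizer_iff.1 hle) with h | h
  · have : a ∈ S i ⊓ (K ⊓ S i) := ⟨ha, subset_closure (by simp), ha⟩
    rw [h, mem_bot] at this
    exact absurd this ha1
  · exact h.trans inf_le_left

end Socle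

/-! ### Bijections that are locally isomorphisms -/

section LocalIso

variable {G H : Type*} [Group G] [Group H]

/-- A subgroup of `G × H` that is the graph of an isomorphism between its two projections: the
kernels of both projections are trivial on it. -/
def IsIsoGraph (R : Subgroup (G × H)) : Prop :=
  ∀ p ∈ R, p.1 = 1 ↔ p.2 = 1

theorem IsIsoGraph.fst_eq_iff {R : Subgroup (G × H)} (hR : IsIsoGraph R) {p q : G × H}
    (hp : p ∈ R) (hq : q ∈ R) : p.1 = q.1 ↔ p.2 = q.2 := by
  have := hR (p * q⁻¹) (R.mul_mem hp (R.inv_mem hq))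
  simpa [mul_inv_eq_one] using this

theorem IsIsoGraph.commute_iff {R : Subgroup (G × H)} (hR : IsIsoGraph R) {p q : G × H}
    (hp : p ∈ R) (hq : q ∈ R) : p.1 * q.1 = q.1 * p.1 ↔ p.2 * q.2 = q.2 * p.2 :=
  hR.fst_eq_iff (R.mul_mem hp hq) (R.mul_mem hq hp)

/-- Together with the fixed pairs `(x, x')` and `(y, y')`, any two values of `f` give a marked
isomorphism. -/
def LocallyIso (x y : G) (x' y' : H) (f : G → H) : Prop :=
  ∀ u v, IsIsoGraph (closure {(x, x'), (y, y'), (u, f u), (v, f v)})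

variable {x y : G} {x' y' : H} {f : G ≃ H}

/-- On `⟨x, y, a⟩` the map `f` agrees with the isomorphism whose graph is generated by the fixed pairs
and `(a, f a)`. For `a ≠ 1` in a simple factor `S`, this applies to all of `S`. -/
theorem LocallyIso.mem_graph (hf : LocallyIso x y x' y' f) {a c : G}
    (hc : c ∈ closure {x, y, a}) : (c, f c) ∈ closure {(x, x'), (y, y'), (a, f a)} := by
  have hmap : (closure {(x, x'), (y, y'), (a, f a)}).map (MonoidHom.fst G H) =
      closure {x, y, a} := by
    rw [MonoidHom.map_closure]
    simp [Set.image_insert_eq]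
  rw [← hmap] at hc
  obtain ⟨⟨c', d⟩, hcd, rfl⟩ := hc
  have hle : closure {(x, x'), (y, y'), (a, f a)} ≤
      closure {(x, x'), (y, y'), (a, f a), (c', f c')} :=
    closure_mono (by
      rintro p (rfl | rfl | rfl) <;> simp)
  have h := ((hf a c').fst_eq_iff (hle hcd) (q := (c', f c')) (subset_closure (by simp))).1 rfl
  have h' : d = f c' := h
  exact h' ▸ hcd

/-- The graph generated by `(g, f g)` and the values of `f` on `S`, for an arbitrary `g`. -/
theorem LocallyIso.exists_graph (hf : LocallyIso x y x' y' f) {S : Subgroup G}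
    (hS : S ∈ socleFactors G) (hgen : ∀ a ∈ S, a ≠ 1 → S ≤ closure {x, y, a}) (g : G) :
    ∃ R : Subgroup (G × H), IsIsoGraph R ∧ (g, f g) ∈ R ∧ ∀ c ∈ S, (c, f c) ∈ R := by
  obtain ⟨a, ha, ha1⟩ := exists_ne_one_of_mem_socleFactors hS
  refine ⟨_, hf a g, subset_closure (by simp), fun c hc => ?_⟩
  have hle : closure {(x, x'), (y, y'), (a, f a)} ≤
      closure {(x, x'), (y, y'), (a, f a), (g, f g)} :=
    closure_mono (by
      rintro p (rfl | rfl | rfl) <;> simp)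
  exact hle (hf.mem_graph (hgen a ha ha1 hc))

/-- The image of a simple factor `S` under `f` is a subgroup isomorphic to `S`. -/
theorem LocallyIso.exists_image (hf : LocallyIso x y x' y' f) {S : Subgroup G}
    (hS : S ∈ socleFactors G) (hgen : ∀ a ∈ S, a ≠ 1 → S ≤ closure {x, y, a}) :
    ∃ T : Subgroup H, IsSimpleGroup T ∧ ∀ c, f c ∈ T ↔ c ∈ S := by
  obtain ⟨R, hR, -, hc⟩ := hf.exists_graph hS hgen 1
  have hmul : ∀ a ∈ S, ∀ b ∈ S, f (a * b) = f a * f b := fun a ha b hb =>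
    (hR.fst_eq_iff (hc _ (S.mul_mem ha hb)) (R.mul_mem (hc a ha) (hc b hb))).1 rfl
  let φ : S →* H := MonoidHom.mk' (fun s => f s) fun a b => hmul a a.2 b b.2
  have hinj : Function.Injective φ := fun a b h => Subtype.ext (f.injective h)
  refine ⟨φ.range,
    ((MonoidHom.ofInjective hinj).isSimpleGroup_congr).1 hS.1, fun c => ?_⟩
  constructor
  · rintro ⟨s, hs⟩
    exact f.injective hs ▸ s.2
  · exact fun hcS => ⟨⟨c, hcS⟩, rfl⟩

/-- Conjugation by `g` preserves `S` if and only if conjugation by `f g` preserves `f S`. -/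
theorem LocallyIso.map_conj_eq_iff (hf : LocallyIso x y x' y' f) {S : Subgroup G}
    (hS : S ∈ socleFactors G) (hgen : ∀ a ∈ S, a ≠ 1 → S ≤ closure {x, y, a})
    {T : Subgroup H} (hT : ∀ c, f c ∈ T ↔ c ∈ S) (g : G) :
    S.map (MulAut.conj g).toMonoidHom = S ↔ T.map (MulAut.conj (f g)).toMonoidHom = T := by
  obtain ⟨R, hR, hg, hc⟩ := hf.exists_graph hS hgen g
  -- an inclusion in either direction transfers along the isomorphism with graph `R`
  have key : ∀ s ∈ S, ∀ r ∈ S, g * s * g⁻¹ = r ↔ f g * f s * (f g)⁻¹ = f r := fun s hs r hr =>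
    hR.fst_eq_iff (R.mul_mem (R.mul_mem hg (hc s hs)) (R.inv_mem hg)) (hc r hr)
  have key' : ∀ s ∈ S, ∀ r ∈ S, g⁻¹ * s * g = r ↔ (f g)⁻¹ * f s * f g = f r := fun s hs r hr =>
    hR.fst_eq_iff (R.mul_mem (R.mul_mem (R.inv_mem hg) (hc s hs)) hg) (hc r hr)
  have hTS : ∀ t, t ∈ T → ∃ s ∈ S, f s = t := fun t ht =>
    ⟨f.symm t, (hT _).1 (by simpa using ht), by simp⟩
  rw [PebbleGame.map_conj_eq_iff, PebbleGame.map_conj_eq_iff]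
  constructor
  · intro h t
    constructor
    · intro ht
      obtain ⟨s, hs, rfl⟩ := hTS t ht
      rw [(key s hs _ ((h s).1 hs)).1 rfl]
      exact (hT _).2 ((h s).1 hs)
    · intro ht
      obtain ⟨s, hs, hst⟩ := hTS _ ht
      have hs' : g⁻¹ * s * g ∈ S := (h _).2 (by simpa [mul_assoc] using hs)
      have h1 : t = (f g)⁻¹ * f s * f g := by
        rw [hst]
        group
      rw [h1, (key' s hs _ hs').1 rfl]
      exact (hT _).2 hs'
  · intro h s
    constructor
    · intro hs
      obtain ⟨r, hr, hrt⟩ := hTS _ ((h _).1 ((hT s).2 hs))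
      rw [(key s hs r hr).2 hrt.symm]
      exact hr
    · intro hs
      have h1 : (f g)⁻¹ * f (g * s * g⁻¹) * f g ∈ T :=
        (h _).2 (by simpa [mul_assoc] using (hT _).2 hs)
      obtain ⟨r, hr, hrt⟩ := hTS _ h1
      have h2 := (key' _ hs r hr).2 hrt.symm
      have h3 : s = r := by
        rw [← h2]
        group
      exact h3 ▸ hr

theorem LocallyIso.image_mem_socleFactors (hf : LocallyIso x y x' y' f) (hH : IsSemisimple H)
    {S : Subgroup G} (hS : S ∈ socleFactors G)
    (hgen : ∀ a ∈ S, a ≠ 1 → S ≤ closure {x, y, a}) :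
    ∃ T ∈ socleFactors H, ∀ c, f c ∈ T ↔ c ∈ S := by
  obtain ⟨T, hTs, hT⟩ := hf.exists_image hS hgen
  refine ⟨T, mem_socleFactors_of_conj hH hTs fun h => ?_, hT⟩
  obtain ⟨g, rfl⟩ := f.surjective h
  rcases hasCommutingConjugates_of_mem_socleFactors hS g with h | h
  · exact Or.inl ((hf.map_conj_eq_iff hS hgen hT g).1 h)
  · right
    intro s hs t ht
    obtain ⟨s, rfl⟩ := f.surjective s
    obtain ⟨t, rfl⟩ := f.surjective t
    rw [hT] at hs ht
    obtain ⟨R, hR, hg, hc⟩ := hf.exists_graph hS hgen g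
    exact (hR.commute_iff (hc s hs)
      (R.mul_mem (R.mul_mem hg (hc t ht)) (R.inv_mem hg))).1 (h s hs t ht)

/-- Every simple factor of the socle of `H` is the image under `f` of one of the socle of `G`. -/
theorem LocallyIso.exists_preimage [Finite G] (hf : LocallyIso x y x' y' f)
    (hG : IsSemisimple G) (hH : IsSemisimple H)
    (hgen : ∀ S ∈ socleFactors G, ∀ a ∈ S, a ≠ 1 → S ≤ closure {x, y, a})
    {T : Subgroup H} (hT : T ∈ socleFactors H) :
    ∃ S ∈ socleFactors G, ∀ c, f c ∈ T ↔ c ∈ S := by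
  by_contra! hno
  obtain ⟨t, ht, ht1⟩ := exists_ne_one_of_mem_socleFactors hT
  obtain ⟨u, rfl⟩ := f.surjective t
  have hu : u = 1 := by
    refine eq_one_of_commute_factors hG fun S hS s hs => ?_
    obtain ⟨T', hT', hST'⟩ := hf.image_mem_socleFactors hH hS (hgen S hS)
    have hne : T ≠ T' := by
      rintro rfl
      obtain ⟨c, hc⟩ := hno S hS
      have := hST' c
      tauto
    have hcomm := commute_of_mem_socleFactors hT hT' hne _ ht _ ((hST' s).2 hs)
    exact ((hf u s).commute_iff (p := (u, f u)) (q := (s, f s))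
      (subset_closure (by simp)) (subset_closure (by simp))).2 hcomm
  subst hu
  exact ht1 ((hf 1 1 (1, f 1) (subset_closure (by simp))).1 rfl)

theorem LocallyIso.restrictsToIso [Finite G] [Finite H] (hf : LocallyIso x y x' y' f)
    (hG : IsSemisimple G) (hH : IsSemisimple H)
    (hgen : ∀ S ∈ socleFactors G, ∀ a ∈ S, a ≠ 1 → S ≤ closure {x, y, a}) :
    RestrictsToIso f (PKer G) (PKer H) := by
  have hmem : ∀ g, g ∈ PKer G ↔ f g ∈ PKer H := by
    intro g
    constructor
    · intro hg T hT
      obtain ⟨S, hS, hST⟩ := hf.exists_preimage hG hH hgen hT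
      exact (hf.map_conj_eq_iff hS (hgen S hS) hST g).1 (hg S hS)
    · intro hg S hS
      obtain ⟨T, hT, hST⟩ := hf.image_mem_socleFactors hH hS (hgen S hS)
      exact (hf.map_conj_eq_iff hS (hgen S hS) hST g).2 (hg T hT)
  have hconj : ∀ g ∈ PKer G, ∀ S ∈ socleFactors G, ∀ s ∈ S,
      f (g * s * g⁻¹) = f g * f s * (f g)⁻¹ := by
    intro g hg S hS s hs
    obtain ⟨R, hR, hgR, hc⟩ := hf.exists_graph hS (hgen S hS) g
    exact (hR.fst_eq_iff (hc _ ((PebbleGame.map_conj_eq_iff.1 (hg S hS) s).1 hs))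
      (R.mul_mem (R.mul_mem hgR (hc s hs)) (R.inv_mem hgR))).1 rfl
  have hmul : ∀ a ∈ PKer G, ∀ b ∈ PKer G, f (a * b) = f a * f b := by
    intro a ha b hb
    rw [← inv_mul_eq_one]
    refine eq_one_of_commute_factors hH fun T hT t ht => ?_
    obtain ⟨S, hS, hST⟩ := hf.exists_preimage hG hH hgen hT
    obtain ⟨s, rfl⟩ := f.surjective t
    have hs := (hST s).1 ht
    have h1 := hconj _ ((PKer G).mul_mem ha hb) S hS s hs
    have h2 := hconj a ha S hS _ ((PebbleGame.map_conj_eq_iff.1 (hb S hS) s).1 hs)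
    rw [hconj b hb S hS s hs] at h2
    have h3 : f (a * b) * f s * (f (a * b))⁻¹ = f a * (f b * f s * (f b)⁻¹) * (f a)⁻¹ := by
      rw [← h1, ← h2]
      congr 1
      group
    calc (f (a * b))⁻¹ * (f a * f b) * f s
        = (f (a * b))⁻¹ * (f a * (f b * f s * (f b)⁻¹) * (f a)⁻¹) * (f a * f b) := by group
      _ = f s * ((f (a * b))⁻¹ * (f a * f b)) := by rw [← h3]; group
  let φ : PKer G →* PKer H :=
    MonoidHom.mk' (fun g => ⟨f g, (hmem g).1 g.2⟩)
      fun a b => Subtype.ext (hmul a a.2 b b.2)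
  have hbij : Function.Bijective φ := by
    constructor
    · exact fun a b h => Subtype.ext (f.injective (congrArg Subtype.val h))
    · rintro ⟨h, hh⟩
      obtain ⟨g, rfl⟩ := f.surjective h
      exact ⟨⟨g, (hmem g).2 hh⟩, rfl⟩
  exact ⟨MulEquiv.ofBijective φ hbij, fun _ => rfl⟩

end LocalIso

/-! ### Positions of the game -/

section Positions

variable {G H : Type*} [Group G] [Group H]

theorem MarkedIsomorphic.isIsoGraph {ι : Type*} {g : ι → G} {h : ι → H}
    (hm : MarkedIsomorphic g h) :
    IsIsoGraph (closure (Set.range fun i => (g i, h i))) := by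
  obtain ⟨-, e, he⟩ := hm
  have key : ∀ p ∈ closure (Set.range fun i => (g i, h i)),
      ∃ hp : p.1 ∈ closure (Set.range g), (e ⟨p.1, hp⟩ : H) = p.2 := by
    intro p hp
    induction hp using closure_induction with
    | mem p hp =>
      obtain ⟨i, rfl⟩ := hp
      exact ⟨subset_closure (Set.mem_range_self i), he i⟩
    | one => exact ⟨one_mem _, congrArg Subtype.val (map_one e)⟩
    | mul p q _ _ ihp ihq =>
      obtain ⟨hp, hp'⟩ := ihp
      obtain ⟨hq, hq'⟩ := ihq
      refine ⟨mul_mem hp hq, ?_⟩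
      have := congrArg Subtype.val (map_mul e ⟨p.1, hp⟩ ⟨q.1, hq⟩)
      rw [Subgroup.coe_mul, hp', hq'] at this
      exact this
    | inv p _ ihp =>
      obtain ⟨hp, hp'⟩ := ihp
      refine ⟨inv_mem hp, ?_⟩
      have := congrArg Subtype.val (map_inv e ⟨p.1, hp⟩)
      rw [Subgroup.coe_inv, hp'] at this
      exact this
  rintro ⟨a, b⟩ hp
  obtain ⟨ha, hab⟩ := key _ hp
  change a = 1 ↔ b = 1
  change (e ⟨a, ha⟩ : H) = b at hab
  rw [← hab, OneMemClass.coe_eq_one, EmbeddingLike.map_eq_one_iff, Subgroup.mk_eq_one]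

theorem Position.GivesMarkedIso.isIsoGraph {k : ℕ} {P : Position G H k}
    (hP : P.GivesMarkedIso) {s : Set (G × H)} (hs : ∀ p ∈ s, ∃ i, P i = some p) :
    IsIsoGraph (closure s) := by
  refine fun p hp => MarkedIsomorphic.isIsoGraph hP p (closure_mono ?_ hp)
  intro q hq
  obtain ⟨i, hi⟩ := hs q hq
  exact ⟨⟨i, by simp [hi]⟩, by simp [hi]⟩

end Positions

end PebbleGame

theorem mainTheorem8 {G H : Type*} [Group G] [Group H] [Finite G] [Finite H]
    (hG : PebbleGame.IsSemisimple G) (hH : PebbleGame.IsSemisimple H)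
    -- `S 0, …, S (m - 1)` are the distinct simple factors of the socle, `S i = ⟨x i, y i⟩`
    (m : ℕ) (S : Fin m → Subgroup G) (hSinj : Function.Injective S)
    (hSrange : Set.range S = PebbleGame.socleFactors G)
    (x y : Fin m → G) (hgen : ∀ i, Subgroup.closure {x i, y i} = S i)
    -- round 1: Duplicator selects `f`, Spoiler places pebbles `0` and `1` on the two products
    (f : G ≃ H) (P : PebbleGame.Position G H 7)
    (hP : P = ((PebbleGame.Position.initial G H 7).pickUp 0 1).place 0 1 f
      (List.ofFn x).prod (List.ofFn y).prod)
    -- round 2: Spoiler picks up two of the five other pebbles, Duplicator selects `f'`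
    (i j : Fin 7) (hij : i ≠ j) (hi : i ≠ 0 ∧ i ≠ 1) (hj : j ≠ 0 ∧ j ≠ 1) (f' : G ≃ H)
    (hf' : ¬ PebbleGame.RestrictsToIso f' (PebbleGame.PKer G) (PebbleGame.PKer H)) :
    PebbleGame.SpoilerWinsAgainst 5 (P.pickUp i j) i j f' := by
  by_contra hlose
  have hS : ∀ i, S i ∈ PebbleGame.socleFactors G := fun i => hSrange ▸ Set.mem_range_self i
  refine hf' (PebbleGame.LocallyIso.restrictsToIso (x := (List.ofFn x).prod)
    (y := (List.ofFn y).prod) (x' := f (List.ofFn x).prod) (y' := f (List.ofFn y).prod)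
    (fun u v => ?_) hG hH ?_)
  · -- Picking up a pair that lies beside the groups has the whole position checked.
    obtain ⟨k, hk⟩ : ∃ k : Fin 7, k ≠ 0 ∧ k ≠ 1 ∧ k ≠ i ∧ k ≠ j := by
      clear hlose
      decide +revert
    obtain ⟨hk0, hk1, hki, hkj⟩ := hk
    have hiso : (((P.pickUp i j).place i j f' u v).pickUp k k).GivesMarkedIso := by
      by_contra hno
      exact hlose ⟨u, v, fun h => absurd h hij, k, k, Or.inl hno⟩
    refine hiso.isIsoGraph ?_
    rintro p (rfl | rfl | rfl | rfl)
    · exact ⟨0, by simp [hP, PebbleGame.Position.pickUp, PebbleGame.Position.place,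
        hk0.symm, hi.1.symm, hj.1.symm]⟩
    · exact ⟨1, by simp [hP, PebbleGame.Position.pickUp, PebbleGame.Position.place,
        hk1.symm, hi.2.symm, hj.2.symm]⟩
    · exact ⟨i, by simp [PebbleGame.Position.pickUp, PebbleGame.Position.place,
        hki.symm, hij]⟩
    · exact ⟨j, by simp [PebbleGame.Position.pickUp, PebbleGame.Position.place,
        hkj.symm]⟩
  · intro T hT
    rw [← hSrange] at hT
    obtain ⟨l, rfl⟩ := hT
    exact fun a ha ha1 => PebbleGame.factor_le_closure hSinj hS hgen l ha ha1
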